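/- **Lemma 2 (Laplace transform of the interference).** Let $\alpha>2$ (path-loss exponent), $\rho_d>0$ (transmit power), and let $\mu,\mathcal P_\delta,\lambda\ge 0$ (the fraction of requesting users, the probability that a node operates in the device-to-device mode $\delta\in\{\mathrm{HD},\mathrm{FD}\}$, and the density of the users; in the application $\mu,\mathcal P_\delta\in[0,1]$). Let the transmitters in mode $\delta$ form a homogeneous Poisson point process $\Phi_\delta=\{z_i\}$ in the plane $\mathbb R^2$ with intensity $\mu\mathcal P_\delta\lambda$, and let the channel power gains $h_i$ (Rayleigh fading) be i.i.d. exponential random variables with mean $1$, independent of $\Phi_\delta$. Let $z_o\in\mathbb R^2$ be the fixed position of the transmitter that serves the typical receiver at the origin. Then the interference at the origin, $$\mathcal I_{d,\delta}=\sum_{z_i\in\Phi_\delta\setminus\{z_o\}}\rho_d\,h_i\,\|z_i\|^{-\alpha},$$ converges almost surely and is a random variable, and for every real $s\ge 0$ its Laplace transform is $$\mathcal L_{\mathcal I_{d,\delta}}(s)=\mathbb E\left[e^{-s\,\mathcal I_{d,\delta}}\right]=\exp\left(-\frac{2\pi^2}{\alpha}\,\mu\,\mathcal P_\delta\,\lambda\,(s\rho_d)^{2/\alpha}\,\csc\left(\frac{2\pi}{\alpha}\right)\right),\qquad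 \csc(x)=\frac1{\sin x}.$$ -/

import Mathlib

open MeasureTheory ProbabilityTheory

noncomputable section

/-- The Euclidean plane, with its Euclidean norm and with Lebesgue measure as `volume`. -/
abbrev Plane : Type := EuclideanSpace ℝ (Fin 2)

/-- A point process in the plane, given by a measurable enumeration of its (finitely or infinitely
many) random points: the points at the outcome `ω` are `point i ω` for the indices
`i < numPoints ω`. -/
structure PlanarPointProcess (Ω : Type*) [MeasurableSpace Ω] where
  numPoints : Ω → ℕ∞
  point : ℕ → Ω → Plane
  measurable_numPoints : Measurable numPoints
  measurable_point : ∀ i, Measurable (point i)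

namespace PlanarPointProcess

variable {Ω : Type*} [MeasurableSpace Ω]

/-- The number of points of the process in `B`, counted with multiplicity. -/
def count (Φ : PlanarPointProcess Ω) (B : Set Plane) (ω : Ω) : ℕ∞ :=
  Set.encard {i : ℕ | (i : ℕ∞) < Φ.numPoints ω ∧ Φ.point i ω ∈ B}

/-- `Φ` is a homogeneous Poisson point process of intensity `lam`: the number of points in a
bounded Borel set `B` is Poisson distributed with mean `lam * |B|`, and the numbers of points in
finitely many pairwise disjoint bounded Borel sets are independent. -/
structure IsPoisson (Φ : PlanarPointProcess Ω) (lam : ℝ) (P : Measure Ω) : Prop where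
  intensity_nonneg : 0 ≤ lam
  hasLaw_count : ∀ B : Set Plane, MeasurableSet B → Bornology.IsBounded B →
    HasLaw (Φ.count B)
      ((poissonMeasure (lam * volume.real B).toNNReal).map (fun n : ℕ => (n : ℕ∞))) P
  indep_count : ∀ (n : ℕ) (B : Fin n → Set Plane),
    (∀ j, MeasurableSet (B j)) → (∀ j, Bornology.IsBounded (B j)) →
    (∀ j k, j ≠ k → Disjoint (B j) (B k)) →
    iIndepFun (fun j => Φ.count (B j)) P

/-- Independent Rayleigh fading with unit mean: the channel power gains `h i`, where `h i` is
attached to the `i`-th point of `Φ`, are i.i.d. exponential of mean one and independent of `Φ`. -/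
structure IsRayleighFading (Φ : PlanarPointProcess Ω) (h : ℕ → Ω → ℝ) (P : Measure Ω) :
    Prop where
  measurable : ∀ i, Measurable (h i)
  hasLaw : ∀ i, HasLaw (h i) (expMeasure 1) P
  indep : iIndepFun h P
  indep_process : IndepFun (fun ω (i : ℕ) => h i ω)
    (fun ω => (Φ.numPoints ω, fun i : ℕ => Φ.point i ω)) P

/-- The indices of the points of `Φ \ {z₀}`. -/
def interferers (Φ : PlanarPointProcess Ω) (z₀ : Plane) (ω : Ω) : Set ℕ :=
  {i : ℕ | (i : ℕ∞) < Φ.numPoints ω ∧ Φ.point i ω ≠ z₀}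

/-- The power `ρ * h i * ‖z i‖ ^ (-α)` received at the origin from the `i`-th point. -/
def receivedPower (Φ : PlanarPointProcess Ω) (h : ℕ → Ω → ℝ) (ρ α : ℝ) (i : ℕ) (ω : Ω) : ℝ :=
  ρ * h i ω * ‖Φ.point i ω‖ ^ (-α)

/-- The interference at the origin: the sum of the received powers over `Φ \ {z₀}`. -/
def interference (Φ : PlanarPointProcess Ω) (h : ℕ → Ω → ℝ) (ρ α : ℝ) (z₀ : Plane) (ω : Ω) : ℝ :=
  ∑' i : Φ.interferers z₀ ω, Φ.receivedPower h ρ α i ω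

end PlanarPointProcess

/-- The Laplace transform `s ↦ 𝔼[exp (-s X)]` of a real random variable `X`. -/
def laplaceTransform {Ω : Type*} [MeasurableSpace Ω] (P : Measure Ω) (X : Ω → ℝ) (s : ℝ) : ℝ :=
  ∫ ω, Real.exp (-s * X ω) ∂P

end

open Filter Topology ENNReal NNReal

/-! The computation takes place in `[0, ∞]`, with `exp (-∞) = 0`, so the Laplace transform of the
sum makes sense before convergence is known. With the points frozen, a unit exponential gain
satisfies `E e^{-a h} = 1/(1+a) = e^{-log (1+a)}`; averaging over the fading thus leaves a Laplace
functional of the Poisson process (`lintegral_expNeg_fadedSum`). By `lintegral_expNeg_pointSum`,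
this equals the exponential of minus the intensity times `∫ a/(1+a)`.

For `a = b r^{-α}` the integrand is `b/(b + r^α) = ∫ b e^{-bt} e^{-t r^α} dt`. Tonelli and polar
coordinates then produce `Γ(2/α) Γ(1 - 2/α)`, and Euler's reflection formula gives the cosecant.

Almost sure convergence comes out of the formula itself: the transform tends to `1` as `s → 0`,
which leaves no mass at `∞`. -/

/-! ### The exponential on `[0, ∞]` and the Poisson generating function. -/

/-- The function `x ↦ exp (-x)` on `[0, ∞]`, with value `0` at `∞`. -/
noncomputable def expNeg (x : ℝ≥0∞) : ℝ≥0∞ := (EReal.exp (x : EReal))⁻¹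

@[simp] lemma expNeg_zero : expNeg 0 = 1 := by simp [expNeg]

@[simp] lemma expNeg_top : expNeg ⊤ = 0 := by simp [expNeg]

lemma expNeg_ofReal {x : ℝ} (hx : 0 ≤ x) :
    expNeg (ENNReal.ofReal x) = ENNReal.ofReal (Real.exp (-x)) := by
  rw [expNeg, EReal.coe_ennreal_ofReal, max_eq_left hx, EReal.exp_coe, Real.exp_neg,
    ENNReal.ofReal_inv_of_pos (Real.exp_pos x)]

lemma continuous_expNeg : Continuous expNeg :=
  continuous_inv.comp (ENNReal.continuous_exp.comp continuous_coe_ennreal_ereal)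

@[fun_prop] lemma measurable_expNeg : Measurable expNeg := continuous_expNeg.measurable

lemma expNeg_add (x y : ℝ≥0∞) : expNeg (x + y) = expNeg x * expNeg y := by
  have hx : EReal.exp (x : EReal) ≠ 0 := by simp
  have hy : EReal.exp (y : EReal) ≠ 0 := by simp
  rw [expNeg, EReal.coe_ennreal_add, EReal.exp_add, ENNReal.mul_inv (Or.inl hx) (Or.inr hy)]
  rfl

lemma antitone_expNeg : Antitone expNeg := fun _ _ hxy =>
  ENNReal.inv_le_inv.2 (EReal.exp_monotone (EReal.coe_ennreal_le_coe_ennreal_iff.2 hxy))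

lemma expNeg_le_one (x : ℝ≥0∞) : expNeg x ≤ 1 :=
  expNeg_zero ▸ antitone_expNeg (zero_le : 0 ≤ x)

lemma expNeg_natCast_mul (n : ℕ) (x : ℝ≥0∞) : expNeg (x * n) = expNeg x ^ n := by
  induction n with
  | zero => simp
  | succ n ih => rw [Nat.cast_succ, mul_add, mul_one, expNeg_add, ih, pow_succ]

lemma expNeg_sum {ι : Type*} (s : Finset ι) (x : ι → ℝ≥0∞) :
    expNeg (∑ i ∈ s, x i) = ∏ i ∈ s, expNeg (x i) := by
  induction s using Finset.cons_induction with
  | empty => simp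
  | cons i s hi ih => rw [Finset.sum_cons, Finset.prod_cons, expNeg_add, ih]

/-- The probability generating function of the Poisson distribution. -/
lemma lintegral_pow_poissonMeasure (r : ℝ≥0) {q : ℝ≥0∞} (hq : q ≤ 1) :
    ∫⁻ n, q ^ n ∂(poissonMeasure r) = expNeg (r * (1 - q)) := by
  lift q to ℝ≥0 using ne_top_of_le_ne_top one_ne_top hq
  have hq' : (q : ℝ) ≤ 1 := by exact_mod_cast hq
  have hs := (NormedSpace.expSeries_div_hasSum_exp ((r : ℝ) * q)).mul_left (Real.exp (-r))
  rw [← Real.exp_eq_exp_ℝ, ← Real.exp_add] at hs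
  have hr : (r : ℝ≥0∞) * (1 - q) = ENNReal.ofReal (r * (1 - q)) := by
    rw [ENNReal.ofReal_mul r.coe_nonneg, ENNReal.ofReal_sub _ q.coe_nonneg]
    simp
  rw [hr, expNeg_ofReal (mul_nonneg r.coe_nonneg (by linarith)),
    show -((r : ℝ) * (1 - q)) = -r + r * q by ring, ← hs.tsum_eq,
    ENNReal.ofReal_tsum_of_nonneg (fun n => by positivity) hs.summable, poissonMeasure,
    lintegral_sum_measure]
  refine tsum_congr fun n => ?_
  rw [lintegral_smul_measure, lintegral_dirac, smul_eq_mul,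
    show (q : ℝ≥0∞) ^ n = ENNReal.ofReal ((q : ℝ) ^ n) by
      rw [ENNReal.ofReal_pow q.coe_nonneg, ENNReal.ofReal_coe_nnreal],
    ← ENNReal.ofReal_mul (by positivity)]
  congr 1
  rw [mul_pow]
  ring

/-- Monotone convergence for the counting measure. -/
lemma tendsto_tsum_of_monotone {g : ℕ → ℕ → ℝ≥0∞} {f : ℕ → ℝ≥0∞}
    (hmono : ∀ i, Monotone fun n => g n i) (hlim : ∀ i, Tendsto (fun n => g n i) atTop (𝓝 (f i))) :
    Tendsto (fun n => ∑' i, g n i) atTop (𝓝 (∑' i, f i)) := by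
  simp_rw [← lintegral_count]
  exact lintegral_tendsto_of_tendsto_of_monotone (fun n => (Measurable.of_discrete).aemeasurable)
    (.of_forall hmono) (.of_forall hlim)

/-! ### The Laplace functional of the Poisson process. -/

namespace PlanarPointProcess

variable {Ω : Type*} [MeasurableSpace Ω]

open Classical in
/-- The sum of `f` over the points of the process. -/
noncomputable def pointSum (Φ : PlanarPointProcess Ω) (f : Plane → ℝ≥0∞) (ω : Ω) : ℝ≥0∞ :=
  ∑' i : ℕ, if (i : ℕ∞) < Φ.numPoints ω then f (Φ.point i ω) else 0

lemma measurable_pointSum (Φ : PlanarPointProcess Ω) {f : Plane → ℝ≥0∞} (hf : Measurable f) :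
    Measurable (Φ.pointSum f) := by
  classical
  refine Measurable.tsum fun i => Measurable.ite ?_ (hf.comp (Φ.measurable_point i))
    measurable_const
  exact Φ.measurable_numPoints (MeasurableSet.of_discrete (s := {n : ℕ∞ | (i : ℕ∞) < n}))

lemma pointSum_indicator (Φ : PlanarPointProcess Ω) (B : Set Plane) (c : ℝ≥0∞) (ω : Ω) :
    Φ.pointSum (B.indicator fun _ => c) ω = c * (Φ.count B ω : ℝ≥0∞) := by
  classical
  rw [count, ← ENNReal.tsum_set_one, tsum_subtype _ (fun _ => (1 : ℝ≥0∞)), ← ENNReal.tsum_mul_left, pointSum]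
  refine tsum_congr fun i => ?_
  by_cases h1 : (i : ℕ∞) < Φ.numPoints ω <;> by_cases h2 : Φ.point i ω ∈ B <;>
    simp [Set.indicator, h1, h2]

lemma pointSum_finset_sum {ι : Type*} (Φ : PlanarPointProcess Ω) (s : Finset ι)
    (f : ι → Plane → ℝ≥0∞) (ω : Ω) :
    Φ.pointSum (fun z => ∑ j ∈ s, f j z) ω = ∑ j ∈ s, Φ.pointSum (f j) ω := by
  classical
  simp only [pointSum]
  rw [← Summable.tsum_finsetSum fun _ _ => ENNReal.summable]
  refine tsum_congr fun i => ?_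
  split_ifs <;> simp

/-- The count is the point sum of an indicator, and `ℕ∞` is countable and embeds in `[0, ∞]`. -/
lemma measurable_count (Φ : PlanarPointProcess Ω) {B : Set Plane} (hB : MeasurableSet B) :
    Measurable (Φ.count B) := by
  have h : Measurable fun ω => ((Φ.count B ω : ℕ∞) : ℝ≥0∞) := by
    have := Φ.measurable_pointSum (f := B.indicator fun _ => 1) (measurable_const.indicator hB)
    simpa [funext (Φ.pointSum_indicator B 1)] using this
  refine measurable_to_countable' fun n => ?_
  have : Φ.count B ⁻¹' {n} = (fun ω => ((Φ.count B ω : ℕ∞) : ℝ≥0∞)) ⁻¹' {(n : ℝ≥0∞)} := by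
    ext ω
    simp
  rw [this]
  exact h (measurableSet_singleton _)

variable {Φ : PlanarPointProcess Ω} {lam : ℝ} {P : Measure Ω}

lemma IsPoisson.lintegral_expNeg_count (hΦ : Φ.IsPoisson lam P) {B : Set Plane}
    (hB : MeasurableSet B) (hb : Bornology.IsBounded B) (c : ℝ≥0∞) :
    ∫⁻ ω, expNeg (c * (Φ.count B ω : ℝ≥0∞)) ∂P =
      expNeg (ENNReal.ofReal lam * ((1 - expNeg c) * volume B)) := by
  have hlaw := (hΦ.hasLaw_count B hB hb).lintegral_comp
    (f := fun n : ℕ∞ => expNeg (c * (n : ℝ≥0∞))) Measurable.of_discrete.aemeasurable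
  rw [hlaw, lintegral_map Measurable.of_discrete Measurable.of_discrete]
  simp only [ENat.toENNReal_coe, expNeg_natCast_mul]
  rw [lintegral_pow_poissonMeasure _ (expNeg_le_one c)]
  congr 1
  have : ((lam * volume.real B).toNNReal : ℝ≥0∞) = ENNReal.ofReal lam * volume B := by
    change ENNReal.ofReal _ = _
    rw [ENNReal.ofReal_mul hΦ.intensity_nonneg, ofReal_measureReal hb.measure_lt_top.ne]
  rw [this]
  ring

lemma IsPoisson.lintegral_expNeg_sum_count (hΦ : Φ.IsPoisson lam P) {ι : Type*} (s : Finset ι)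
    (B : ι → Set Plane) (c : ι → ℝ≥0∞) (hB : ∀ j ∈ s, MeasurableSet (B j))
    (hb : ∀ j ∈ s, Bornology.IsBounded (B j))
    (hd : ∀ j ∈ s, ∀ k ∈ s, j ≠ k → Disjoint (B j) (B k)) :
    ∫⁻ ω, expNeg (∑ j ∈ s, c j * (Φ.count (B j) ω : ℝ≥0∞)) ∂P =
      expNeg (ENNReal.ofReal lam * ∑ j ∈ s, (1 - expNeg (c j)) * volume (B j)) := by
  -- Reindexing by `Fin s.card`, the form in which `indep_count` supplies independence.
  have he : ∀ f : ι → ℝ≥0∞, ∏ j ∈ s, f j = ∏ k, f (s.equivFin.symm k) := fun f => by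
    rw [← Finset.prod_coe_sort, ← s.equivFin.symm.prod_comp]
  have hind := (hΦ.indep_count s.card (fun k => B (s.equivFin.symm k))
    (fun k => hB _ (s.equivFin.symm k).2) (fun k => hb _ (s.equivFin.symm k).2)
    (fun k l hkl => hd _ (s.equivFin.symm k).2 _ (s.equivFin.symm l).2
      fun h => hkl (s.equivFin.symm.injective (Subtype.ext h)))).comp
    (fun k (n : ℕ∞) => expNeg (c (s.equivFin.symm k) * (n : ℝ≥0∞)))
    (fun k => Measurable.of_discrete)
  have hprod := lintegral_prod_eq_prod_lintegral_of_indepFun Finset.univ _ hind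
    (fun k => Measurable.of_discrete.comp (Φ.measurable_count (hB _ (s.equivFin.symm k).2)))
  simp only [expNeg_sum, Finset.mul_sum]
  simp only [he]
  refine hprod.trans (Finset.prod_congr rfl fun k _ => ?_)
  exact hΦ.lintegral_expNeg_count (hB _ (s.equivFin.symm k).2) (hb _ (s.equivFin.symm k).2) _

lemma IsPoisson.lintegral_expNeg_pointSum_simpleFunc (hΦ : Φ.IsPoisson lam P)
    (g : SimpleFunc Plane ℝ≥0∞) (hg : Bornology.IsBounded (Function.support g)) :
    ∫⁻ ω, expNeg (Φ.pointSum g ω) ∂P =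
      expNeg (ENNReal.ofReal lam * ∫⁻ z, (1 - expNeg (g z))) := by
  classical
  -- The value `0` is dropped: its level set is unbounded, and it contributes nothing to either
  -- side.
  set s := g.range.filter (· ≠ 0)
  have hsum : ∀ ω, Φ.pointSum g ω = ∑ c ∈ s, c * (Φ.count (g ⁻¹' {c}) ω : ℝ≥0∞) := fun ω => by
    simp_rw [← pointSum_indicator, ← pointSum_finset_sum]
    congr 1
    ext z
    have : ∀ c, (g ⁻¹' {c}).indicator (fun _ => c) z = if g z = c then c else 0 := fun c => by
      simp [Set.indicator]
    simp only [this, Finset.sum_ite_eq]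
    by_cases hz : g z = 0 <;> simp [s, hz]
  have hint : ∫⁻ z, (1 - expNeg (g z)) = ∑ c ∈ s, (1 - expNeg c) * volume (g ⁻¹' {c}) := by
    have h1 : ∫⁻ z, (1 - expNeg (g z)) = (g.map fun c => 1 - expNeg c).lintegral volume := by
      rw [← SimpleFunc.lintegral_eq_lintegral]
      rfl
    rw [h1, SimpleFunc.map_lintegral, Finset.sum_filter]
    refine Finset.sum_congr rfl fun c _ => ?_
    by_cases hc : c = 0 <;> simp [hc]
  simp only [hsum, hint]
  refine hΦ.lintegral_expNeg_sum_count s _ _ (fun c _ => g.measurableSet_fiber c)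
    (fun c hc => hg.subset ?_) (fun c _ d _ hcd => ?_)
  · rintro z rfl
    exact (Finset.mem_filter.1 hc).2
  · exact Disjoint.preimage _ (by simpa using hcd)

/-- The Laplace functional of a homogeneous Poisson point process. -/
theorem IsPoisson.lintegral_expNeg_pointSum [IsProbabilityMeasure P] (hΦ : Φ.IsPoisson lam P)
    {f : Plane → ℝ≥0∞} (hf : Measurable f) :
    ∫⁻ ω, expNeg (Φ.pointSum f ω) ∂P =
      expNeg (ENNReal.ofReal lam * ∫⁻ z, (1 - expNeg (f z))) := by
  -- Cutting off to growing balls gives bounded supports and keeps the approximation monotone.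
  set g : ℕ → SimpleFunc Plane ℝ≥0∞ := fun n =>
    (SimpleFunc.eapprox f n).restrict (Metric.ball 0 n)
  have hgdef : ∀ n z, g n z = (Metric.ball (0 : Plane) n).indicator (SimpleFunc.eapprox f n) z :=
    fun n z => SimpleFunc.restrict_apply _ measurableSet_ball z
  have hmono : ∀ z, Monotone fun n => g n z := fun z m n hmn => by
    simp only [hgdef]
    refine (Set.indicator_le_indicator (SimpleFunc.monotone_eapprox f hmn z)).trans ?_
    exact Set.indicator_le_indicator_of_subset
      (Metric.ball_subset_ball (by exact_mod_cast hmn)) (fun _ => zero_le) z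
  have hlim : ∀ z, Tendsto (fun n => g n z) atTop (𝓝 (f z)) := fun z => by
    refine (SimpleFunc.tendsto_eapprox hf z).congr' ?_
    obtain ⟨N, hN⟩ := exists_nat_gt ‖z‖
    filter_upwards [eventually_ge_atTop N] with n hn
    rw [hgdef, Set.indicator_of_mem]
    rw [mem_ball_zero_iff]
    exact hN.trans_le (by exact_mod_cast hn)
  have hg : ∀ n, ∫⁻ ω, expNeg (Φ.pointSum (g n) ω) ∂P =
      expNeg (ENNReal.ofReal lam * ∫⁻ z, (1 - expNeg (g n z))) := fun n => by
    refine hΦ.lintegral_expNeg_pointSum_simpleFunc _ ((Metric.isBounded_ball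
      (x := (0 : Plane)) (r := (n : ℝ))).subset fun z hz => ?_)
    by_contra h
    exact hz (by rw [hgdef, Set.indicator_of_notMem h])
  have hleft : Tendsto (fun n => ∫⁻ ω, expNeg (Φ.pointSum (g n) ω) ∂P) atTop
      (𝓝 (∫⁻ ω, expNeg (Φ.pointSum f ω) ∂P)) := by
    refine tendsto_lintegral_of_dominated_convergence (fun _ => 1)
      (fun n => measurable_expNeg.comp (Φ.measurable_pointSum (g n).measurable))
      (fun n => .of_forall fun ω => expNeg_le_one _) (by simp) (.of_forall fun ω => ?_)
    refine (continuous_expNeg.tendsto _).comp ?_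
    refine tendsto_tsum_of_monotone (fun i => ?_) (fun i => ?_)
    · split_ifs
      exacts [hmono _, monotone_const]
    · split_ifs
      exacts [hlim _, tendsto_const_nhds]
  have hright : Tendsto (fun n => expNeg (ENNReal.ofReal lam * ∫⁻ z, (1 - expNeg (g n z)))) atTop
      (𝓝 (expNeg (ENNReal.ofReal lam * ∫⁻ z, (1 - expNeg (f z))))) := by
    refine (continuous_expNeg.tendsto _).comp (ENNReal.Tendsto.const_mul ?_ (Or.inr ofReal_ne_top))
    refine lintegral_tendsto_of_tendsto_of_monotone
      (fun n => (by fun_prop : Measurable fun z => 1 - expNeg (g n z)).aemeasurable)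
      (.of_forall fun z m n hmn => tsub_le_tsub_left (antitone_expNeg (hmono z hmn)) _)
      (.of_forall fun z => ENNReal.Tendsto.sub tendsto_const_nhds
        ((continuous_expNeg.tendsto _).comp (hlim z)) (Or.inl one_ne_top))
  exact tendsto_nhds_unique hleft (hright.congr fun n => (hg n).symm)

end PlanarPointProcess

/-! ### Averaging over the exponential gains. -/

lemma expMeasure_eq_withDensity (r : ℝ) :
    expMeasure r = volume.withDensity (exponentialPDF r) := rfl

lemma ae_nonneg_expMeasure (r : ℝ) : ∀ᵐ x ∂(expMeasure r), 0 ≤ x := by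
  simp only [ae_iff, not_le]
  change expMeasure r (Set.Iio 0) = 0
  rw [expMeasure_eq_withDensity, withDensity_apply _ measurableSet_Iio,
    lintegral_exponentialPDF_of_nonpos le_rfl]

/-- The Laplace transform of the exponential distribution of mean one. -/
lemma lintegral_expNeg_expMeasure {a : ℝ} (ha : 0 ≤ a) :
    ∫⁻ x, expNeg (ENNReal.ofReal (a * x)) ∂(expMeasure 1) =
      expNeg (ENNReal.ofReal (Real.log (1 + a))) := by
  have hpdf : ∀ r : ℝ, Measurable (exponentialPDF r) := fun r =>
    (measurable_exponentialPDFReal r).ennreal_ofReal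
  rw [expNeg_ofReal (Real.log_nonneg (by linarith)), Real.exp_neg, Real.exp_log (by linarith),
    expMeasure_eq_withDensity, lintegral_withDensity_eq_lintegral_mul _ (hpdf 1) (by fun_prop)]
  -- Tilting by `e^{-ax}` turns the rate `1` density into `(1+a)⁻¹` times the rate `1 + a` density.
  have : ∀ x, (exponentialPDF 1 * fun x => expNeg (ENNReal.ofReal (a * x))) x =
      ENNReal.ofReal (1 + a)⁻¹ * exponentialPDF (1 + a) x := fun x => by
    rcases lt_or_ge x 0 with hx | hx
    · simp [exponentialPDF_of_neg hx]
    · rw [Pi.mul_apply, exponentialPDF_of_nonneg hx, exponentialPDF_of_nonneg hx,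
        expNeg_ofReal (mul_nonneg ha hx), ← ENNReal.ofReal_mul (by positivity),
        ← ENNReal.ofReal_mul (by positivity), ← mul_assoc, inv_mul_cancel₀ (by positivity),
        mul_assoc, ← Real.exp_add]
      congr 3
      ring
  simp only [this]
  rw [lintegral_const_mul _ (hpdf _), lintegral_exponentialPDF_eq_one (by linarith), mul_one]

/-- The Laplace transform of a weighted sum of independent exponential variables. -/
lemma lintegral_expNeg_tsum_exponential {Ω : Type*} [MeasurableSpace Ω] {P : Measure Ω}
    {h : ℕ → Ω → ℝ} (hm : ∀ i, Measurable (h i)) (hlaw : ∀ i, HasLaw (h i) (expMeasure 1) P)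
    (hind : iIndepFun h P) {a : ℕ → ℝ} (ha : ∀ i, 0 ≤ a i) :
    ∫⁻ ω, expNeg (∑' i, ENNReal.ofReal (a i * h i ω)) ∂P =
      expNeg (∑' i, ENNReal.ofReal (Real.log (1 + a i))) := by
  have : IsProbabilityMeasure P := hind.isProbabilityMeasure
  have hmeas : ∀ i, Measurable fun x : ℝ => expNeg (ENNReal.ofReal (a i * x)) := fun i => by
    fun_prop
  have hfin : ∀ n : ℕ, ∫⁻ ω, expNeg (∑ i ∈ Finset.range n, ENNReal.ofReal (a i * h i ω)) ∂P =
      expNeg (∑ i ∈ Finset.range n, ENNReal.ofReal (Real.log (1 + a i))) := fun n => by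
    simp only [expNeg_sum]
    refine (lintegral_prod_eq_prod_lintegral_of_indepFun (Finset.range n) _
      (hind.comp _ hmeas) fun i => (hmeas i).comp (hm i)).trans
        (Finset.prod_congr rfl fun i _ => ?_)
    rw [← lintegral_expNeg_expMeasure (ha i)]
    exact (hlaw i).lintegral_comp (hmeas i).aemeasurable
  have hleft : Tendsto
      (fun n => ∫⁻ ω, expNeg (∑ i ∈ Finset.range n, ENNReal.ofReal (a i * h i ω)) ∂P) atTop
      (𝓝 (∫⁻ ω, expNeg (∑' i, ENNReal.ofReal (a i * h i ω)) ∂P)) := by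
    refine tendsto_lintegral_of_dominated_convergence (fun _ => 1)
      (fun n => by fun_prop) (fun n => .of_forall fun ω => expNeg_le_one _) (by simp)
      (.of_forall fun ω => ?_)
    exact (continuous_expNeg.tendsto _).comp (ENNReal.tendsto_nat_tsum _)
  refine tendsto_nhds_unique hleft (Tendsto.congr (fun n => (hfin n).symm) ?_)
  exact (continuous_expNeg.tendsto _).comp (ENNReal.tendsto_nat_tsum _)

namespace PlanarPointProcess

variable {Ω : Type*} [MeasurableSpace Ω] {Φ : PlanarPointProcess Ω} {P : Measure Ω}

open Classical in
/-- The sum over the points of the process of the attenuation `a z` times the gain at `z`. -/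
noncomputable def fadedSum (Φ : PlanarPointProcess Ω) (h : ℕ → Ω → ℝ) (a : Plane → ℝ) (ω : Ω) :
    ℝ≥0∞ :=
  ∑' i : ℕ, if (i : ℕ∞) < Φ.numPoints ω then ENNReal.ofReal (a (Φ.point i ω) * h i ω) else 0

lemma measurable_fadedSum (Φ : PlanarPointProcess Ω) {h : ℕ → Ω → ℝ} (hh : ∀ i, Measurable (h i))
    {a : Plane → ℝ} (ha : Measurable a) : Measurable (Φ.fadedSum h a) := by
  classical
  refine Measurable.tsum fun i => Measurable.ite ?_
    ((ha.comp (Φ.measurable_point i)).mul (hh i)).ennreal_ofReal measurable_const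
  exact Φ.measurable_numPoints (MeasurableSet.of_discrete (s := {n : ℕ∞ | (i : ℕ∞) < n}))

/-- Averaging over the fading turns the attenuation `a` into `log (1 + a)`. -/
lemma IsRayleighFading.lintegral_expNeg_fadedSum [IsProbabilityMeasure P] {h : ℕ → Ω → ℝ}
    (hh : Φ.IsRayleighFading h P) {a : Plane → ℝ} (ha : Measurable a) (ha0 : ∀ z, 0 ≤ a z) :
    ∫⁻ ω, expNeg (Φ.fadedSum h a ω) ∂P =
      ∫⁻ ω, expNeg (Φ.pointSum (fun z => ENNReal.ofReal (Real.log (1 + a z))) ω) ∂P := by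
  classical
  set X : Ω → ℕ → ℝ := fun ω i => h i ω
  set Y : Ω → ℕ∞ × (ℕ → Plane) := fun ω => (Φ.numPoints ω, fun i => Φ.point i ω)
  have hX : Measurable X := measurable_pi_lambda _ hh.measurable
  have hY : Measurable Y :=
    Φ.measurable_numPoints.prodMk (measurable_pi_lambda _ Φ.measurable_point)
  set F : (ℕ → ℝ) × (ℕ∞ × (ℕ → Plane)) → ℝ≥0∞ := fun q => expNeg
    (∑' i : ℕ, if (i : ℕ∞) < q.2.1 then ENNReal.ofReal (a (q.2.2 i) * q.1 i) else 0)
  have hF : Measurable F := by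
    refine measurable_expNeg.comp (Measurable.tsum fun i => Measurable.ite ?_ ?_ measurable_const)
    · exact (measurable_fst.comp measurable_snd)
        (MeasurableSet.of_discrete (s := {n : ℕ∞ | (i : ℕ∞) < n}))
    · fun_prop
  -- The joint law is a product, so the gains can be integrated first with the points frozen.
  have hjoint := (indepFun_iff_map_prod_eq_prod_map_map hX.aemeasurable hY.aemeasurable).1
    hh.indep_process
  have : IsProbabilityMeasure (P.map X) := Measure.isProbabilityMeasure_map hX.aemeasurable
  have : IsProbabilityMeasure (P.map Y) := Measure.isProbabilityMeasure_map hY.aemeasurable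
  calc ∫⁻ ω, expNeg (Φ.fadedSum h a ω) ∂P
      = ∫⁻ q, F q ∂(P.map fun ω => (X ω, Y ω)) := (lintegral_map hF (hX.prodMk hY)).symm
    _ = ∫⁻ y, ∫⁻ x, F (x, y) ∂(P.map X) ∂(P.map Y) := by
        rw [hjoint, lintegral_prod_symm' _ hF]
    _ = ∫⁻ ω, ∫⁻ x, F (x, Y ω) ∂(P.map X) ∂P := lintegral_map hF.lintegral_prod_left' hY
    _ = _ := lintegral_congr fun ω => ?_
  rw [lintegral_map (f := fun x => F (x, Y ω)) (hF.comp measurable_prodMk_right) hX]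
  have := lintegral_expNeg_tsum_exponential hh.measurable hh.hasLaw hh.indep
    -- Absent indices get weight `0`, and `log (1 + 0) = 0`.
    (a := fun i => if (i : ℕ∞) < Φ.numPoints ω then a (Φ.point i ω) else 0)
    (fun i => by split_ifs; exacts [ha0 _, le_rfl])
  convert this using 1
  · refine lintegral_congr fun ω' => congrArg expNeg (tsum_congr fun i => ?_)
    simp only [Y, X]
    split_ifs <;> simp
  · refine congrArg expNeg (tsum_congr fun i => ?_)
    split_ifs <;> simp

lemma IsRayleighFading.ae_nonneg {h : ℕ → Ω → ℝ} (hh : Φ.IsRayleighFading h P) :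
    ∀ᵐ ω ∂P, ∀ i, 0 ≤ h i ω :=
  ae_all_iff.2 fun i => ((hh.hasLaw i).ae_iff (measurableSet_Ici.mem)).2 (ae_nonneg_expMeasure 1)

/-- The Laplace transform of the faded sum over a homogeneous Poisson point process. -/
theorem IsRayleighFading.lintegral_expNeg_fadedSum_of_isPoisson [IsProbabilityMeasure P]
    {lam : ℝ} (hΦ : Φ.IsPoisson lam P) {h : ℕ → Ω → ℝ} (hh : Φ.IsRayleighFading h P)
    {a : Plane → ℝ} (ha : Measurable a) (ha0 : ∀ z, 0 ≤ a z) :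
    ∫⁻ ω, expNeg (Φ.fadedSum h a ω) ∂P =
      expNeg (ENNReal.ofReal lam * ∫⁻ z, ENNReal.ofReal (a z / (1 + a z))) := by
  rw [hh.lintegral_expNeg_fadedSum ha ha0, hΦ.lintegral_expNeg_pointSum (by fun_prop)]
  congr 2
  refine lintegral_congr fun z => ?_
  have := ha0 z
  rw [expNeg_ofReal (Real.log_nonneg (by linarith)), Real.exp_neg, Real.exp_log (by linarith),
    ← ENNReal.ofReal_one, ← ENNReal.ofReal_sub _ (by positivity)]
  congr 1
  field_simp
  ring

end PlanarPointProcess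

/-! ### The area integral. -/

lemma lintegral_rpow_mul_exp_neg_mul_rpow {p q b : ℝ} (hp : 0 < p) (hq : -1 < q) (hb : 0 < b) :
    ∫⁻ x in Set.Ioi (0 : ℝ), ENNReal.ofReal (x ^ q * Real.exp (-b * x ^ p)) =
      ENNReal.ofReal (b ^ (-(q + 1) / p) * (1 / p) * Real.Gamma ((q + 1) / p)) := by
  rw [← integral_rpow_mul_exp_neg_mul_rpow hp hq hb,
    ofReal_integral_eq_lintegral_ofReal (integrableOn_rpow_mul_exp_neg_mul_rpow hq hp hb)]
  refine (ae_restrict_mem measurableSet_Ioi).mono fun x (hx : 0 < x) => ?_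
  simp only [Pi.zero_apply]
  positivity

/-- Polar coordinates reduce this to the Gamma integral of `r e^{-t r^α}`. -/
lemma Plane.lintegral_exp_neg_mul_norm_rpow {α t : ℝ} (hα : 0 < α) (ht : 0 < t) :
    ∫⁻ z : Plane, ENNReal.ofReal (Real.exp (-t * ‖z‖ ^ α)) =
      ENNReal.ofReal (2 * Real.pi / α * Real.Gamma (2 / α) * t ^ (-(2 / α))) := by
  have hfun : ∀ y : ℝ, y ^ (Module.finrank ℝ Plane - 1) • Real.exp (-t * y ^ α) =
      y ^ (1 : ℝ) * Real.exp (-t * y ^ α) := fun y => by simp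
  have hint : Integrable (fun z : Plane => Real.exp (-t * ‖z‖ ^ α)) := by
    refine (integrable_fun_norm_addHaar volume (f := fun y => Real.exp (-t * y ^ α))).2 ?_
    simp only [hfun]
    exact integrableOn_rpow_mul_exp_neg_mul_rpow (by norm_num) hα ht
  rw [← ofReal_integral_eq_lintegral_ofReal hint (.of_forall fun z => (Real.exp_pos _).le),
    integral_fun_norm_addHaar volume (fun y => Real.exp (-t * y ^ α))]
  simp only [hfun]
  rw [integral_rpow_mul_exp_neg_mul_rpow hα (by norm_num) ht, measureReal_def,
    EuclideanSpace.volume_ball_fin_two]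
  congr 1
  norm_num [Real.pi_pos.le, neg_div]
  ring

/-- The area integral of `b ‖z‖ ^ (-α) / (1 + b ‖z‖ ^ (-α))` over the plane. -/
theorem Plane.lintegral_mul_norm_rpow_div {α b : ℝ} (hα : 2 < α) (hb : 0 ≤ b) :
    ∫⁻ z : Plane, ENNReal.ofReal (b * ‖z‖ ^ (-α) / (1 + b * ‖z‖ ^ (-α))) =
      ENNReal.ofReal (2 * Real.pi ^ 2 / α * b ^ (2 / α) * (1 / Real.sin (2 / α * Real.pi))) := by
  have hα0 : 0 < α := by linarith
  have h2α : 2 / α < 1 := by rw [div_lt_one hα0]; exact hα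
  have h2α0 : 0 < 2 / α := by positivity
  rcases hb.eq_or_lt with rfl | hb
  · simp [Real.zero_rpow h2α0.ne']
  -- The origin is excluded: there `0 ^ (-α) = 0` makes the left side `0`, while the right side is
  -- `1`.
  have hmix : ∀ z : Plane, z ≠ 0 →
      ENNReal.ofReal (b * ‖z‖ ^ (-α) / (1 + b * ‖z‖ ^ (-α))) =
        ∫⁻ t in Set.Ioi (0 : ℝ),
          ENNReal.ofReal (b * Real.exp (-b * t)) * ENNReal.ofReal (Real.exp (-t * ‖z‖ ^ α)) := by
    intro z hz
    have hz' : 0 < ‖z‖ := norm_pos_iff.2 hz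
    have hza : 0 < ‖z‖ ^ α := Real.rpow_pos_of_pos hz' α
    have h1 := lintegral_rpow_mul_exp_neg_mul_rpow (p := 1) (q := 0) (b := b + ‖z‖ ^ α)
      one_pos (by norm_num) (by positivity)
    have h2 : ∀ t : ℝ,
        ENNReal.ofReal (b * Real.exp (-b * t)) * ENNReal.ofReal (Real.exp (-t * ‖z‖ ^ α)) =
        ENNReal.ofReal b *
          ENNReal.ofReal (t ^ (0 : ℝ) * Real.exp (-(b + ‖z‖ ^ α) * t ^ (1 : ℝ))) := fun t => by
      rw [← ENNReal.ofReal_mul (by positivity), ← ENNReal.ofReal_mul hb.le, mul_assoc,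
        ← Real.exp_add, Real.rpow_zero, one_mul, Real.rpow_one]
      congr 3
      ring
    simp only [h2]
    rw [lintegral_const_mul _ (by fun_prop), h1, ← ENNReal.ofReal_mul hb.le]
    congr 1
    rw [Real.rpow_neg hz'.le]
    norm_num [Real.rpow_neg_one]
    field_simp
    ring
  have hne : ∀ᵐ z : Plane, z ≠ 0 := by simp [ae_iff]
  calc ∫⁻ z : Plane, ENNReal.ofReal (b * ‖z‖ ^ (-α) / (1 + b * ‖z‖ ^ (-α)))
      = ∫⁻ z : Plane, ∫⁻ t in Set.Ioi (0 : ℝ),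
          ENNReal.ofReal (b * Real.exp (-b * t)) * ENNReal.ofReal (Real.exp (-t * ‖z‖ ^ α)) :=
        lintegral_congr_ae (hne.mono hmix)
    _ = ∫⁻ t in Set.Ioi (0 : ℝ), ∫⁻ z : Plane,
          ENNReal.ofReal (b * Real.exp (-b * t)) * ENNReal.ofReal (Real.exp (-t * ‖z‖ ^ α)) :=
        lintegral_lintegral_swap (by fun_prop)
    _ = ∫⁻ t in Set.Ioi (0 : ℝ), ENNReal.ofReal (b * (2 * Real.pi / α * Real.Gamma (2 / α))) *
          ENNReal.ofReal (t ^ (-(2 / α)) * Real.exp (-b * t ^ (1 : ℝ))) := by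
        refine setLIntegral_congr_fun measurableSet_Ioi fun t (ht : 0 < t) => ?_
        have hΓ := Real.Gamma_pos_of_pos h2α0
        have hπ := Real.pi_pos
        rw [lintegral_const_mul _ (by fun_prop), Plane.lintegral_exp_neg_mul_norm_rpow hα0 ht,
          ← ENNReal.ofReal_mul (by positivity), ← ENNReal.ofReal_mul (by positivity),
          Real.rpow_one]
        congr 1
        ring
    _ = _ := by
        have hΓ := Real.Gamma_pos_of_pos h2α0
        have hπ := Real.pi_pos
        -- Here `α > 2` is essential: `t ^ (-(2/α))` must be integrable at `0`.
        rw [lintegral_const_mul _ (by fun_prop),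
          lintegral_rpow_mul_exp_neg_mul_rpow one_pos (by linarith) hb,
          ← ENNReal.ofReal_mul (by positivity)]
        congr 1
        have hrefl := Real.Gamma_mul_Gamma_one_sub (2 / α)
        rw [div_one, div_one, show -(-(2 / α) + 1) = 2 / α - 1 by ring,
          show -(2 / α) + 1 = 1 - 2 / α by ring, Real.rpow_sub_one hb.ne']
        calc _ = 2 * Real.pi / α * b ^ (2 / α) *
              (Real.Gamma (2 / α) * Real.Gamma (1 - 2 / α)) := by field_simp
          _ = _ := by rw [hrefl, mul_comm Real.pi (2 / α)]; ring

/-! ### Almost sure finiteness and the interference. -/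

/-- A `[0, ∞]`-valued random variable whose Laplace transform tends to `1` along a sequence
tending to `0` is almost surely finite. -/
lemma ae_ne_top_of_tendsto_lintegral_expNeg {Ω : Type*} [MeasurableSpace Ω] {P : Measure Ω}
    [IsProbabilityMeasure P] {X : Ω → ℝ≥0∞} (hX : Measurable X) {u : ℕ → ℝ≥0∞}
    (hu0 : ∀ n, u n ≠ 0) (hu : Tendsto u atTop (𝓝 0))
    (hlim : Tendsto (fun n => ∫⁻ ω, expNeg (u n * X ω) ∂P) atTop (𝓝 1)) :
    ∀ᵐ ω ∂P, X ω ≠ ⊤ := by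
  have hm : MeasurableSet {ω | X ω ≠ ⊤} := (hX (measurableSet_singleton ⊤)).compl
  -- Since `u n ≠ 0`, the integrand vanishes where `X = ∞` and tends to `1` elsewhere.
  have hlim' : Tendsto (fun n => ∫⁻ ω, expNeg (u n * X ω) ∂P) atTop
      (𝓝 (∫⁻ ω, {ω | X ω ≠ ⊤}.indicator 1 ω ∂P)) := by
    refine tendsto_lintegral_of_dominated_convergence (fun _ => 1)
      (fun n => by fun_prop) (fun n => .of_forall fun ω => expNeg_le_one _) (by simp)
      (.of_forall fun ω => ?_)
    by_cases h : X ω = ⊤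
    · simp [h, ENNReal.mul_top (hu0 _)]
    · have h1 : Tendsto (fun n => u n * X ω) atTop (𝓝 0) := by
        simpa using ENNReal.Tendsto.mul_const hu (Or.inr h)
      simpa [h, Function.comp_def] using (continuous_expNeg.tendsto 0).comp h1
  have h1 := tendsto_nhds_unique hlim' hlim
  rw [lintegral_indicator_one hm] at h1
  exact (prob_compl_eq_zero_iff hm).2 h1

namespace PlanarPointProcess

variable {Ω : Type*} [MeasurableSpace Ω]

open Classical in
/-- The attenuation `ρ ‖z‖ ^ (-α)` of the signal sent from `z`, with the site `z₀` removed. -/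
noncomputable def attenuation (ρ α : ℝ) (z₀ z : Plane) : ℝ :=
  if z = z₀ then 0 else ρ * ‖z‖ ^ (-α)

lemma attenuation_nonneg {ρ : ℝ} (hρ : 0 ≤ ρ) (α : ℝ) (z₀ z : Plane) :
    0 ≤ attenuation ρ α z₀ z := by
  rw [attenuation]
  split_ifs
  exacts [le_rfl, by positivity]

lemma measurable_attenuation (ρ α : ℝ) (z₀ : Plane) : Measurable (attenuation ρ α z₀) :=
  Measurable.ite (measurableSet_singleton z₀) measurable_const (by fun_prop)

lemma ofReal_mul_fadedSum (Φ : PlanarPointProcess Ω) (h : ℕ → Ω → ℝ) {s : ℝ} (hs : 0 ≤ s)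
    (a : Plane → ℝ) (ω : Ω) :
    ENNReal.ofReal s * Φ.fadedSum h a ω = Φ.fadedSum h (fun z => s * a z) ω := by
  simp only [fadedSum]
  rw [← ENNReal.tsum_mul_left]
  refine tsum_congr fun i => ?_
  rw [mul_ite, mul_zero, mul_assoc, ENNReal.ofReal_mul hs]

open Classical in
lemma interferers_indicator_receivedPower {Φ : PlanarPointProcess Ω} {h : ℕ → Ω → ℝ} {ρ : ℝ}
    (hρ : 0 ≤ ρ) (α : ℝ) (z₀ : Plane) {ω : Ω} (hω : ∀ i, 0 ≤ h i ω) (i : ℕ) :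
    (Φ.interferers z₀ ω).indicator (fun i => Φ.receivedPower h ρ α i ω) i =
      (if (i : ℕ∞) < Φ.numPoints ω then
        ENNReal.ofReal (attenuation ρ α z₀ (Φ.point i ω) * h i ω) else 0).toReal := by
  by_cases h1 : (i : ℕ∞) < Φ.numPoints ω
  · rw [if_pos h1, ENNReal.toReal_ofReal (mul_nonneg (attenuation_nonneg hρ _ _ _) (hω i))]
    by_cases h2 : Φ.point i ω = z₀ <;>
      simp [Set.indicator, interferers, h1, h2, attenuation, receivedPower, mul_right_comm]
  · simp [Set.indicator, interferers, h1]

lemma summable_receivedPower {Φ : PlanarPointProcess Ω} {h : ℕ → Ω → ℝ} {ρ α : ℝ}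
    (hρ : 0 ≤ ρ) {z₀ : Plane} {ω : Ω} (hω : ∀ i, 0 ≤ h i ω)
    (hfin : Φ.fadedSum h (attenuation ρ α z₀) ω ≠ ⊤) :
    Summable fun i : Φ.interferers z₀ ω => Φ.receivedPower h ρ α i ω := by
  classical
  refine summable_subtype_iff_indicator (f := fun i => Φ.receivedPower h ρ α i ω).2 ?_
  rw [funext (interferers_indicator_receivedPower hρ α z₀ hω)]
  exact ENNReal.summable_toReal hfin

/-- No finiteness is needed: a divergent real sum and `⊤.toReal` are both `0`. -/
lemma interference_eq_toReal_fadedSum {Φ : PlanarPointProcess Ω} {h : ℕ → Ω → ℝ} {ρ : ℝ}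
    (hρ : 0 ≤ ρ) (α : ℝ) (z₀ : Plane) {ω : Ω} (hω : ∀ i, 0 ≤ h i ω) :
    Φ.interference h ρ α z₀ ω = (Φ.fadedSum h (attenuation ρ α z₀) ω).toReal := by
  classical
  rw [interference, tsum_subtype _ (fun i => Φ.receivedPower h ρ α i ω),
    funext (interferers_indicator_receivedPower hρ α z₀ hω), fadedSum, ENNReal.tsum_toReal_eq]
  intro i
  split_ifs <;> simp

/-- Removing `z₀` alters the integrand only on a null set. -/
lemma lintegral_attenuation_div {s ρ α : ℝ} (hs : 0 ≤ s) (hρ : 0 ≤ ρ) (hα : 2 < α) (z₀ : Plane) :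
    ∫⁻ z, ENNReal.ofReal (s * attenuation ρ α z₀ z / (1 + s * attenuation ρ α z₀ z)) =
      ENNReal.ofReal (2 * Real.pi ^ 2 / α * (s * ρ) ^ (2 / α) *
        (1 / Real.sin (2 / α * Real.pi))) := by
  rw [← Plane.lintegral_mul_norm_rpow_div hα (mul_nonneg hs hρ)]
  have hne : ∀ᵐ z : Plane, z ≠ z₀ := by simp [ae_iff]
  refine lintegral_congr_ae (hne.mono fun z hz => ?_)
  simp only [attenuation, if_neg hz, mul_assoc]

/-- The Laplace transform of the interference, as a `[0, ∞]`-valued random variable. -/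
lemma IsRayleighFading.lintegral_expNeg_mul_interference {Φ : PlanarPointProcess Ω}
    {P : Measure Ω} [IsProbabilityMeasure P] {lam : ℝ} (hΦ : Φ.IsPoisson lam P)
    {h : ℕ → Ω → ℝ} (hh : Φ.IsRayleighFading h P) {s ρ α : ℝ} (hs : 0 ≤ s) (hρ : 0 ≤ ρ)
    (hα : 2 < α) (z₀ : Plane) :
    ∫⁻ ω, expNeg (ENNReal.ofReal s * Φ.fadedSum h (attenuation ρ α z₀) ω) ∂P =
      ENNReal.ofReal (Real.exp (-(2 * Real.pi ^ 2 / α) * lam * (s * ρ) ^ (2 / α) *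
        (1 / Real.sin (2 / α * Real.pi)))) := by
  have hsin : 0 ≤ Real.sin (2 / α * Real.pi) := by
    refine Real.sin_nonneg_of_nonneg_of_le_pi (by positivity) ?_
    exact mul_le_of_le_one_left Real.pi_pos.le ((div_le_one (by linarith)).2 hα.le)
  have hlam := hΦ.intensity_nonneg
  have hπ := Real.pi_pos
  simp only [ofReal_mul_fadedSum _ _ hs]
  rw [hh.lintegral_expNeg_fadedSum_of_isPoisson hΦ ((measurable_attenuation ρ α z₀).const_mul s)
    fun z => mul_nonneg hs (attenuation_nonneg hρ α z₀ z), lintegral_attenuation_div hs hρ hα,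
    ← ENNReal.ofReal_mul hlam, expNeg_ofReal (by positivity)]
  congr 2
  ring

lemma IsRayleighFading.ae_fadedSum_ne_top {Φ : PlanarPointProcess Ω}
    {P : Measure Ω} [IsProbabilityMeasure P] {lam : ℝ} (hΦ : Φ.IsPoisson lam P)
    {h : ℕ → Ω → ℝ} (hh : Φ.IsRayleighFading h P) {ρ α : ℝ} (hρ : 0 ≤ ρ)
    (hα : 2 < α) (z₀ : Plane) :
    ∀ᵐ ω ∂P, Φ.fadedSum h (attenuation ρ α z₀) ω ≠ ⊤ := by
  have hu := tendsto_one_div_add_atTop_nhds_zero_nat (𝕜 := ℝ)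
  have hα0 : 0 < 2 / α := by positivity
  refine ae_ne_top_of_tendsto_lintegral_expNeg
    (Φ.measurable_fadedSum hh.measurable (measurable_attenuation ρ α z₀))
    (u := fun n => ENNReal.ofReal (1 / ((n : ℝ) + 1)))
    (fun n => (ENNReal.ofReal_pos.2 (by positivity)).ne')
    (by simpa using ENNReal.tendsto_ofReal hu) ?_
  have hl := fun n : ℕ => hh.lintegral_expNeg_mul_interference hΦ
    (s := 1 / ((n : ℝ) + 1)) (by positivity) hρ hα z₀
  simp only [hl]
  have hcont : Continuous fun s : ℝ => ENNReal.ofReal (Real.exp (-(2 * Real.pi ^ 2 / α) * lam *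
      (s * ρ) ^ (2 / α) * (1 / Real.sin (2 / α * Real.pi)))) := by
    have : Continuous fun s : ℝ => (s * ρ) ^ (2 / α) :=
      (Real.continuous_rpow_const hα0.le).comp (by fun_prop)
    exact ENNReal.continuous_ofReal.comp (by fun_prop)
  have := (hcont.tendsto 0).comp hu
  simpa [Real.zero_rpow hα0.ne', Function.comp_def] using this

end PlanarPointProcess

theorem lemma2 {Ω : Type*} [MeasurableSpace Ω] (P : Measure Ω) [IsProbabilityMeasure P]
    (μ p lam ρ α s : ℝ) (hμ : 0 ≤ μ) (hp : 0 ≤ p) (hlam : 0 ≤ lam) (hρ : 0 < ρ) (hα : 2 < α)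
    (hs : 0 ≤ s)
    (Φ : PlanarPointProcess Ω) (hΦ : Φ.IsPoisson (μ * p * lam) P)
    (h : ℕ → Ω → ℝ) (hh : Φ.IsRayleighFading h P)
    (z₀ : Plane) :
    (∀ᵐ ω ∂P, Summable fun i : Φ.interferers z₀ ω => Φ.receivedPower h ρ α i ω) ∧
    AEMeasurable (Φ.interference h ρ α z₀) P ∧
    laplaceTransform P (Φ.interference h ρ α z₀) s =
      Real.exp (-(2 * Real.pi ^ 2 / α) * (μ * p * lam) * (s * ρ) ^ (2 / α) *
        (1 / Real.sin (2 / α * Real.pi))) := by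
  have hfin := hh.ae_fadedSum_ne_top hΦ hρ.le hα z₀
  have hmeas := Φ.measurable_fadedSum hh.measurable
    (PlanarPointProcess.measurable_attenuation ρ α z₀)
  have heq : Φ.interference h ρ α z₀ =ᵐ[P]
      fun ω => (Φ.fadedSum h (PlanarPointProcess.attenuation ρ α z₀) ω).toReal :=
    hh.ae_nonneg.mono fun ω hω =>
      PlanarPointProcess.interference_eq_toReal_fadedSum hρ.le α z₀ hω
  refine ⟨?_, hmeas.ennreal_toReal.aemeasurable.congr heq.symm, ?_⟩
  · filter_upwards [hfin, hh.ae_nonneg] with ω h1 h2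
    exact PlanarPointProcess.summable_receivedPower hρ.le h2 h1
  · rw [laplaceTransform, ← ENNReal.toReal_ofReal (Real.exp_pos (-(2 * Real.pi ^ 2 / α) *
      (μ * p * lam) * (s * ρ) ^ (2 / α) * (1 / Real.sin (2 / α * Real.pi)))).le,
      ← hh.lintegral_expNeg_mul_interference hΦ hs hρ.le hα z₀,
      integral_congr_ae (heq.mono fun ω hω => by simp only [hω]; rfl),
      integral_eq_lintegral_of_nonneg_ae (.of_forall fun ω => (Real.exp_pos _).le)
        (Real.measurable_exp.comp (hmeas.ennreal_toReal.const_mul (-s))).aestronglyMeasurable]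
    -- Finiteness is essential here: at `∞` the real integrand would be `e^0 = 1` instead of `0`
    -- when `s > 0`.
    refine congrArg _ (lintegral_congr_ae (hfin.mono fun ω hω => ?_))
    simp only
    rw [neg_mul, ← expNeg_ofReal (mul_nonneg hs ENNReal.toReal_nonneg), ENNReal.ofReal_mul hs,
      ENNReal.ofReal_toReal hω]
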